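/- Let $G=(V,E)$ be a finite simple graph. For $S\subseteq V$ let $G\setminus S$ denote the graph obtained by removing the vertices of $S$ and their incident edges, write $G\setminus x$ for $G\setminus\{x\}$, and let $N[x]=\{x\}\cup\{y : \{x,y\}\in E\}$. The graph $G$ is *well-covered* if all of its maximal (with respect to inclusion) independent sets have the same cardinality. Recursively, $G$ is *vertex decomposable* if $G$ is well-covered and either $G$ has no edges (possibly no vertices), or there is a vertex $x\in V$ such that both $G\setminus x$ and $G\setminus N[x]$ are vertex decomposable. Put $$\mathrm{Shed}(G)=\{x\in V : G\setminus x \text{ and } G\setminus N[x] \text{ are vertex decomposable}\}.$$ **Theorem.** Let $G$ be a finite simple graph of girth at least five (a graph without cycles has infinite girth). If $G$ is vertex decomposable, then $\mathrm{Shed}(G)$ is a dominating set of $G$, that is, every vertex of $V\setminus\mathrm{Shed}(G)$ is adjacent to a vertex of $\mathrm{Shed}(G)$. -/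

import Mathlib

universe u

/-- All maximal (with respect to inclusion) independent sets of `G` have the same cardinality.
Used for graphs on a finite vertex set. -/
def SimpleGraph.IsWellCovered {V : Type u} (G : SimpleGraph V) : Prop :=
  ∀ s t : Set V, Maximal G.IsIndepSet s → Maximal G.IsIndepSet t → s.ncard = t.ncard

/-- The closed neighbourhood `N[x] = N(x) ∪ {x}`. -/
def SimpleGraph.closedNeighborSet {V : Type u} (G : SimpleGraph V) (x : V) : Set V :=
  G.neighborSet x ∪ {x}

/-- `G \ S`: the graph obtained by removing the vertices in `S` and all their incident edges. -/
abbrev SimpleGraph.removeVerts {V : Type u} (G : SimpleGraph V) (S : Set V) :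
    SimpleGraph (Sᶜ : Set V) :=
  G.induce Sᶜ

/-- Vertex decomposable graphs (the pure version): `G` is well-covered and either consists of
isolated vertices (possibly none), or has a vertex `x` such that `G \ x` and `G \ N[x]` are
vertex decomposable. -/
inductive SimpleGraph.IsVertexDecomposable : ∀ {V : Type u}, SimpleGraph V → Prop
  | isolated {V : Type u} (G : SimpleGraph V) (hwc : G.IsWellCovered) (h : G = ⊥) :
      SimpleGraph.IsVertexDecomposable G
  | shedding {V : Type u} (G : SimpleGraph V) (hwc : G.IsWellCovered) (x : V)
      (hdel : SimpleGraph.IsVertexDecomposable (G.removeVerts {x}))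
      (hlink : SimpleGraph.IsVertexDecomposable (G.removeVerts (G.closedNeighborSet x))) :
      SimpleGraph.IsVertexDecomposable G

/-- `Shed(G)`: the vertices `x` such that `G \ x` and `G \ N[x]` are vertex decomposable. -/
def SimpleGraph.shed {V : Type u} (G : SimpleGraph V) : Set V :=
  {x | (G.removeVerts {x}).IsVertexDecomposable ∧
    (G.removeVerts (G.closedNeighborSet x)).IsVertexDecomposable}

/-- Every vertex outside `D` is adjacent to a vertex of `D`. -/
def SimpleGraph.IsDominatingSet {V : Type u} (G : SimpleGraph V) (D : Set V) : Prop :=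
  ∀ x, x ∉ D → ∃ y ∈ D, G.Adj x y

/-!
A graph of girth at least five has no triangles and no four-cycles. Call a vertex *standard* if it
is isolated, a leaf, a neighbour of a leaf, or on a *basic* five-cycle, one on which no two
consecutive vertices both have neighbours off the cycle. The proof shows that all vertices of a
vertex decomposable graph without short cycles are standard
(`VertexDecomposableOn.standardVertex`), and then finds deletable vertices near standard ones.

The structural part is an induction along a shedding vertex `x`. It uses that `A \ {x}` and
`A \ N[x]` consist of standard vertices, and two consequences of well-coveredness: removing the
closed neighbourhood of an independent set never leaves two leaves at one vertex
(`WellCoveredOn.not_two_leaves`), and no independent set avoiding `N[x]` dominates the neighbours of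
`x` (`WellCoveredOn.not_dominates_neighbors`). Basic five-cycles of `A \ {x}` stay basic in `A`
(`BasicFiveCycleIn.of_deleted`), so only `x`, the leaves of `A \ {x}` attached to `x`, and their
neighbours need attention (`standardVertex_near_deleted`). If `x` does not carry a leaf, each
neighbour of `x` is dominated by a vertex with few neighbours. As these dominators cannot form an
independent set, two of them are adjacent, which is only possible for the neighbours `q`, `q'` of
two leaves `p`, `p'` of `A \ {x}` attached to `x`. Then `x p q q' p'` is a basic five-cycle.

For the deletions, links of arbitrary vertices are vertex decomposable, and so is a vertex
decomposable graph with an isolated vertex added. If `q` is the neighbour of a leaf `p`, then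
`A \ {q}` is the link of `p` with `p` added as an isolated vertex. On a five-cycle `a b c d e` in
which `b`, `d`, `e` have degree two, `a` can be deleted, with `c` as the next shedding vertex; every
vertex of a basic five-cycle is such an `a` or adjacent to one.
-/

namespace SimpleGraph

variable {V : Type u} {G : SimpleGraph V} {A B S : Set V}

/-! ### Well-covered and vertex decomposable vertex sets -/

/-- `s` is an independent set of `G` contained in `A`, that is, an independent set of the subgraph
of `G` induced on `A`. -/
def IndepIn (G : SimpleGraph V) (A s : Set V) : Prop :=
  s ⊆ A ∧ G.IsIndepSet s

/-- The subgraph of `G` induced on `A` is well-covered. -/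
def WellCoveredOn (G : SimpleGraph V) (A : Set V) : Prop :=
  ∀ s t : Set V, Maximal (G.IndepIn A) s → Maximal (G.IndepIn A) t → s.ncard = t.ncard

/-- The subgraph of `G` induced on `A` is vertex decomposable. All the graphs of the recursion are
recorded as subsets of the one vertex type `V`, so that no iterated subtypes occur. -/
inductive VertexDecomposableOn (G : SimpleGraph V) : Set V → Prop
  | isolated (A : Set V) (hwc : G.WellCoveredOn A) (h : ∀ a ∈ A, ∀ b ∈ A, ¬ G.Adj a b) :
      VertexDecomposableOn G A
  | shedding (A : Set V) (hwc : G.WellCoveredOn A) (x : V) (hx : x ∈ A)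
      (hdel : VertexDecomposableOn G (A \ {x}))
      (hlink : VertexDecomposableOn G (A \ G.closedNeighborSet x)) :
      VertexDecomposableOn G A

theorem mem_closedNeighborSet {x y : V} : y ∈ G.closedNeighborSet x ↔ G.Adj x y ∨ y = x := by
  simp [closedNeighborSet, or_comm]

theorem VertexDecomposableOn.wellCoveredOn (h : G.VertexDecomposableOn A) :
    G.WellCoveredOn A := by
  cases h <;> assumption

section Transfer

variable {W : Type u} {H : SimpleGraph W}

theorem Embedding.indepIn_image (f : H ↪g G) (s : Set W) :
    G.IndepIn (Set.range f) (f '' s) ↔ H.IsIndepSet s := by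
  constructor
  · rintro ⟨-, h⟩ a ha b hb hab hadj
    exact h ⟨a, ha, rfl⟩ ⟨b, hb, rfl⟩ (f.injective.ne hab) (f.map_adj_iff.2 hadj)
  · rintro h
    refine ⟨Set.image_subset_range _ _, ?_⟩
    rintro _ ⟨a, ha, rfl⟩ _ ⟨b, hb, rfl⟩ hab hadj
    exact h ha hb (fun e => hab (e ▸ rfl)) (f.map_adj_iff.1 hadj)

theorem Embedding.maximal_indepIn_image (f : H ↪g G) (s : Set W) :
    Maximal (G.IndepIn (Set.range f)) (f '' s) ↔ Maximal H.IsIndepSet s := by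
  constructor
  · rintro ⟨h, hm⟩
    refine ⟨(f.indepIn_image s).1 h, fun t ht hst => ?_⟩
    have := hm ((f.indepIn_image t).2 ht) (Set.image_mono hst)
    exact (Set.image_subset_image_iff f.injective).1 this
  · rintro ⟨h, hm⟩
    refine ⟨(f.indepIn_image s).2 h, fun t ht hst => ?_⟩
    obtain ⟨t, rfl⟩ := Set.subset_range_iff_exists_image_eq.1 ht.1
    exact Set.image_mono
      (hm ((f.indepIn_image t).1 ht) ((Set.image_subset_image_iff f.injective).1 hst))

theorem Embedding.wellCoveredOn_range (f : H ↪g G) :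
    G.WellCoveredOn (Set.range f) ↔ H.IsWellCovered := by
  constructor
  · intro h s t hs ht
    have := h _ _ ((f.maximal_indepIn_image s).2 hs) ((f.maximal_indepIn_image t).2 ht)
    rwa [Set.ncard_image_of_injective _ f.injective,
      Set.ncard_image_of_injective _ f.injective] at this
  · intro h s t hs ht
    obtain ⟨s, rfl⟩ := Set.subset_range_iff_exists_image_eq.1 hs.1.1
    obtain ⟨t, rfl⟩ := Set.subset_range_iff_exists_image_eq.1 ht.1.1
    rw [Set.ncard_image_of_injective _ f.injective, Set.ncard_image_of_injective _ f.injective]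
    exact h _ _ ((f.maximal_indepIn_image s).1 hs) ((f.maximal_indepIn_image t).1 ht)

theorem Embedding.range_comp_removeVerts (f : H ↪g G) (s : Set W) :
    Set.range (f.comp (Embedding.induce (G := H) sᶜ)) = Set.range f \ f '' s := by
  ext v
  constructor
  · rintro ⟨⟨w, hw⟩, rfl⟩
    refine ⟨⟨w, rfl⟩, ?_⟩
    rintro ⟨w', hw', e⟩
    have e : w' = w := f.injective e
    exact hw (e ▸ hw')
  · rintro ⟨⟨w, rfl⟩, hw⟩
    exact ⟨⟨w, fun h => hw ⟨w, h, rfl⟩⟩, rfl⟩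

theorem Embedding.range_diff_closedNeighborSet (f : H ↪g G) (x : W) :
    Set.range f \ f '' H.closedNeighborSet x = Set.range f \ G.closedNeighborSet (f x) := by
  ext v
  simp only [Set.mem_sdiff, Set.mem_range, Set.mem_image, mem_closedNeighborSet]
  refine and_congr_right ?_
  rintro ⟨w, rfl⟩
  refine not_congr ⟨?_, ?_⟩
  · rintro ⟨w', hw', e⟩
    obtain rfl := f.injective e
    exact hw'.imp f.map_adj_iff.2 (congrArg f)
  · exact fun h => ⟨w, h.imp f.map_adj_iff.1 fun e : f w = f x => f.injective e, rfl⟩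

/-- Stated for all embeddings of `H` at once, since the recursion passes to smaller vertex types. -/
theorem IsVertexDecomposable.vertexDecomposableOn_range (h : H.IsVertexDecomposable) :
    ∀ {V : Type u} {G : SimpleGraph V} (f : H ↪g G), G.VertexDecomposableOn (Set.range f) := by
  induction h with
  | isolated H hwc hH =>
    intro V G f
    refine .isolated _ (f.wellCoveredOn_range.2 hwc) ?_
    rintro _ ⟨a, rfl⟩ _ ⟨b, rfl⟩ hab
    have := f.map_adj_iff.1 hab
    simp [hH] at this
  | shedding H hwc x _ _ ih₁ ih₂ =>
    intro V G f
    refine .shedding _ (f.wellCoveredOn_range.2 hwc) (f x) ⟨x, rfl⟩ ?_ ?_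
    · have := ih₁ (f.comp (Embedding.induce (G := H) {x}ᶜ))
      rwa [f.range_comp_removeVerts, Set.image_singleton] at this
    · have := ih₂ (f.comp (Embedding.induce (G := H) (H.closedNeighborSet x)ᶜ))
      rwa [f.range_comp_removeVerts, f.range_diff_closedNeighborSet] at this

theorem VertexDecomposableOn.isVertexDecomposable (h : G.VertexDecomposableOn A) :
    ∀ {W : Type u} {H : SimpleGraph W} (f : H ↪g G), Set.range f = A →
      H.IsVertexDecomposable := by
  induction h with
  | isolated A hwc hA =>
    rintro W H f rfl
    refine .isolated _ (f.wellCoveredOn_range.1 hwc) ?_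
    ext a b
    simpa using fun hab => hA _ ⟨a, rfl⟩ _ ⟨b, rfl⟩ (f.map_adj_iff.2 hab)
  | shedding A hwc x hx _ _ ih₁ ih₂ =>
    rintro W H f rfl
    obtain ⟨x, rfl⟩ := hx
    refine .shedding _ (f.wellCoveredOn_range.1 hwc) x
      (ih₁ (f.comp (Embedding.induce (G := H) {x}ᶜ)) ?_)
      (ih₂ (f.comp (Embedding.induce (G := H) (H.closedNeighborSet x)ᶜ)) ?_)
    · rw [f.range_comp_removeVerts, Set.image_singleton]
    · rw [f.range_comp_removeVerts, f.range_diff_closedNeighborSet]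

theorem vertexDecomposableOn_univ (h : G.IsVertexDecomposable) :
    G.VertexDecomposableOn Set.univ := by
  have := h.vertexDecomposableOn_range (Embedding.refl (G := G))
  rwa [show Set.range (Embedding.refl (G := G)) = Set.univ from Set.range_id] at this

theorem mem_shed_of_vertexDecomposableOn {x : V} (h₁ : G.VertexDecomposableOn (Set.univ \ {x}))
    (h₂ : G.VertexDecomposableOn (Set.univ \ G.closedNeighborSet x)) : x ∈ G.shed := by
  refine ⟨h₁.isVertexDecomposable (Embedding.induce _) ?_,
    h₂.isVertexDecomposable (Embedding.induce _) ?_⟩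
  · ext; simp [Embedding.induce]
  · ext; simp [Embedding.induce]

end Transfer

/-! ### Extension arguments in well-covered graphs -/

theorem IndepIn.insert {x : V} (hS : G.IndepIn A S) (hx : x ∈ A) (h : ∀ s ∈ S, ¬ G.Adj s x) :
    G.IndepIn A (insert x S) := by
  refine ⟨Set.insert_subset hx hS.1, ?_⟩
  rintro a (rfl | ha) b (rfl | hb) hab
  · exact absurd rfl hab
  · exact fun e => h _ hb e.symm
  · exact h _ ha
  · exact hS.2 ha hb hab

theorem IndepIn.mono {T : Set V} (hS : G.IndepIn A S) (h : T ⊆ S) : G.IndepIn A T :=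
  ⟨h.trans hS.1, hS.2.mono h⟩

theorem IndepIn.not_adj {a b : V} (hS : G.IndepIn A S) (ha : a ∈ S) (hb : b ∈ S) :
    ¬ G.Adj a b := fun h => hS.2 ha hb h.ne h

theorem indepIn_singleton {x : V} (hx : x ∈ A) : G.IndepIn A {x} :=
  ⟨by simpa using hx, Set.pairwise_singleton _ _⟩

theorem indepIn_pair {x y : V} (hx : x ∈ A) (hy : y ∈ A) (h : ¬ G.Adj x y) :
    G.IndepIn A {x, y} :=
  (indepIn_singleton hy).insert hx (by rintro s rfl e; exact h e.symm)

theorem exists_maximal_indepIn [Finite V] (hS : G.IndepIn A S) :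
    ∃ M, S ⊆ M ∧ Maximal (G.IndepIn A) M :=
  (Set.toFinite {s | G.IndepIn A s}).exists_le_maximal hS

theorem maximal_indepIn_iff :
    Maximal (G.IndepIn A) S ↔ G.IndepIn A S ∧ ∀ v ∈ A, v ∉ S → ∃ s ∈ S, G.Adj s v := by
  constructor
  · rintro ⟨h, hm⟩
    refine ⟨h, fun v hv hvS => ?_⟩
    by_contra! hc
    exact hvS (hm (h.insert hv hc) (Set.subset_insert _ _) (Set.mem_insert _ _))
  · rintro ⟨h, hm⟩
    refine ⟨h, fun T hT hST v hv => ?_⟩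
    by_contra hvS
    obtain ⟨s, hs, hsv⟩ := hm v (hT.1 hv) hvS
    exact hT.not_adj (hST hs) hv hsv

theorem WellCoveredOn.ncard_le [Finite V] {M T : Set V} (h : G.WellCoveredOn A)
    (hM : Maximal (G.IndepIn A) M) (hT : G.IndepIn A T) : T.ncard ≤ M.ncard := by
  obtain ⟨N, hTN, hN⟩ := exists_maximal_indepIn hT
  rw [h _ _ hM hN]
  exact Set.ncard_le_ncard hTN

/-- In a well-covered graph, removing the closed neighbourhood of an independent set `S` cannot
leave two leaves at the same vertex: exchanging the common neighbour `x` for the leaves `y`, `z`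
would enlarge a maximal independent set. -/
theorem WellCoveredOn.not_two_leaves [Finite V] (h : G.WellCoveredOn A) (hS : G.IndepIn A S)
    {x y z : V} (hx : x ∈ A) (hy : y ∈ A) (hz : z ∈ A) (hyz : y ≠ z) (hxy : G.Adj y x)
    (hxz : G.Adj z x) (hxS : ∀ s ∈ S, ¬ G.Adj s x) (hyS : ∀ s ∈ S, ¬ G.Adj s y)
    (hzS : ∀ s ∈ S, ¬ G.Adj s z)
    (hy' : ∀ u ∈ A, G.Adj y u → u = x ∨ ∃ s ∈ S, G.Adj s u)
    (hz' : ∀ u ∈ A, G.Adj z u → u = x ∨ ∃ s ∈ S, G.Adj s u) : False := by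
  obtain ⟨M, hSM, hM⟩ := exists_maximal_indepIn (hS.insert hx hxS)
  have hxM : x ∈ M := hSM (Set.mem_insert _ _)
  have hSM : S ⊆ M := (Set.subset_insert _ _).trans hSM
  have key : ∀ w, (∀ u ∈ A, G.Adj w u → u = x ∨ ∃ s ∈ S, G.Adj s u) →
      ∀ s ∈ M \ {x}, ¬ G.Adj s w := by
    rintro w hw s ⟨hs, hsx⟩ hsw
    rcases hw s (hM.1.1 hs) hsw.symm with rfl | ⟨t, ht, hts⟩
    · exact hsx rfl
    · exact hM.1.not_adj (hSM ht) hs hts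
  have hnyz : ¬ G.Adj z y := by
    intro hzy
    rcases hz' y hy hzy with rfl | ⟨s, hs, hsy⟩
    · exact G.loopless.irrefl _ hxy
    · exact hyS s hs hsy
  have h1 : G.IndepIn A (insert z (M \ {x})) := (hM.1.mono Set.sdiff_subset).insert hz (key z hz')
  have h2 : G.IndepIn A (insert y (insert z (M \ {x}))) := by
    refine h1.insert hy ?_
    rintro s (rfl | hs)
    · exact hnyz
    · exact key y hy' s hs
  have hzM : z ∉ M := fun hzM => hM.1.not_adj hzM hxM hxz
  have hyM : y ∉ M := fun hyM => hM.1.not_adj hyM hxM hxy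
  have hle := h.ncard_le hM h2
  rw [Set.ncard_insert_of_notMem (by simp [hyz, hyM]),
    Set.ncard_insert_of_notMem (by simp [hzM])] at hle
  have := Set.ncard_sdiff_singleton_add_one hxM
  omega

/-- If both `A` and `A \ {x}` are well-covered and `x` is not isolated, then no independent set
avoiding the closed neighbourhood of `x` dominates all neighbours of `x`. -/
theorem WellCoveredOn.not_dominates_neighbors [Finite V] (h : G.WellCoveredOn A) {x y : V}
    (h' : G.WellCoveredOn (A \ {x})) (hx : x ∈ A) (hy : y ∈ A) (hxy : G.Adj x y)
    (hS : G.IndepIn A S) (hxS : x ∉ S)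
    (hdom : ∀ u ∈ A, G.Adj x u → ∃ s ∈ S, G.Adj s u) : False := by
  have hS' : G.IndepIn (A \ {x}) S :=
    ⟨fun s hs => ⟨hS.1 hs, fun e => hxS (by rwa [← show s = x from e])⟩, hS.2⟩
  obtain ⟨T, hST, hT⟩ := exists_maximal_indepIn hS'
  have hTx : ∀ t ∈ T, ¬ G.Adj t x := by
    intro t ht htx
    obtain ⟨s, hs, hst⟩ := hdom t (hT.1.1 ht).1 htx.symm
    exact hT.1.not_adj (hST hs) ht hst
  have hT2 : G.IndepIn A (insert x T) :=
    IndepIn.insert ⟨hT.1.1.trans Set.sdiff_subset, hT.1.2⟩ hx hTx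
  obtain ⟨M, hyM, hM⟩ := exists_maximal_indepIn (indepIn_singleton (G := G) hy)
  have hyM : y ∈ M := hyM rfl
  have hxM : x ∉ M := fun hxM => hM.1.not_adj hxM hyM hxy
  have hM' : G.IndepIn (A \ {x}) M :=
    ⟨fun s hs => ⟨hM.1.1 hs, fun e => hxM (by rwa [← show s = x from e])⟩, hM.1.2⟩
  have h1 := h.ncard_le hM hT2
  have h2 := h'.ncard_le hT hM'
  rw [Set.ncard_insert_of_notMem (fun hxT => (hT.1.1 hxT).2 rfl)] at h1
  omega

/-- A maximal independent set of `A \ N[v]` becomes one of `A` on adding `v`. -/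
theorem WellCoveredOn.diff_closedNeighborSet [Finite V] (h : G.WellCoveredOn A) {v : V}
    (hv : v ∈ A) : G.WellCoveredOn (A \ G.closedNeighborSet v) := by
  have key : ∀ s, Maximal (G.IndepIn (A \ G.closedNeighborSet v)) s →
      Maximal (G.IndepIn A) (insert v s) ∧ v ∉ s := by
    intro s hs
    rw [maximal_indepIn_iff] at hs
    obtain ⟨hs, hm⟩ := hs
    refine ⟨maximal_indepIn_iff.2
      ⟨IndepIn.insert ⟨hs.1.trans Set.sdiff_subset, hs.2⟩ hv ?_, ?_⟩, ?_⟩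
    · exact fun s' hs' e => (hs.1 hs').2 (mem_closedNeighborSet.2 (.inl e.symm))
    · intro u hu hus
      rw [Set.mem_insert_iff, not_or] at hus
      by_cases huv : G.Adj v u
      · exact ⟨v, Set.mem_insert _ _, huv⟩
      · obtain ⟨t, ht, htu⟩ := hm u ⟨hu, by simp [mem_closedNeighborSet, huv, hus.1]⟩ hus.2
        exact ⟨t, Set.mem_insert_of_mem _ ht, htu⟩
    · exact fun hvs => (hs.1 hvs).2 (mem_closedNeighborSet.2 (.inr rfl))
  intro s t hs ht
  have := h _ _ (key s hs).1 (key t ht).1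
  rw [Set.ncard_insert_of_notMem (key s hs).2, Set.ncard_insert_of_notMem (key t ht).2] at this
  omega

/-! ### Vertex decomposability of links and of isolated extensions -/

/-- Links of all vertices, not only of shedding vertices, are vertex decomposable. -/
theorem VertexDecomposableOn.diff_closedNeighborSet [Finite V] (h : G.VertexDecomposableOn A) :
    ∀ v ∈ A, G.VertexDecomposableOn (A \ G.closedNeighborSet v) := by
  induction h with
  | isolated A hwc hA =>
    exact fun v hv => .isolated _ (hwc.diff_closedNeighborSet hv)
      fun a ha b hb => hA a ha.1 b hb.1
  | shedding A hwc x hx h₁ h₂ ih₁ ih₂ =>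
    intro v hv
    by_cases hvx : v = x
    · rwa [hvx]
    have e₁ := ih₁ v ⟨hv, hvx⟩
    rw [Set.sdiff_sdiff_comm] at e₁
    by_cases hadj : G.Adj v x
    · rwa [Set.sdiff_singleton_eq_self
        (fun hx => hx.2 (mem_closedNeighborSet.2 (.inl hadj)))] at e₁
    · have e₂ := ih₂ v ⟨hv, by simp [mem_closedNeighborSet, hvx, G.adj_comm x v, hadj]⟩
      rw [Set.sdiff_sdiff_comm] at e₂
      exact .shedding _ (hwc.diff_closedNeighborSet hv) x
        ⟨hx, by simp [mem_closedNeighborSet, hadj, Ne.symm hvx]⟩ e₁ e₂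

theorem VertexDecomposableOn.insert_isolated {y : V} (h : G.VertexDecomposableOn A)
    (hyA : y ∉ A) (hy : ∀ u ∈ A, ¬ G.Adj y u) [Finite V] :
    G.VertexDecomposableOn (insert y A) := by
  have e₁ : insert y A \ {y} = A := by simp [hyA]
  have e₂ : insert y A \ G.closedNeighborSet y = A := by
    ext u
    simp only [Set.mem_sdiff, Set.mem_insert_iff, mem_closedNeighborSet]
    constructor
    · rintro ⟨rfl | hu, hn⟩
      · exact absurd (.inr rfl) hn
      · exact hu
    · exact fun hu => ⟨.inr hu, fun hc => hc.elim (hy u hu) (fun e => hyA (e ▸ hu))⟩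
  refine .shedding _ ?_ y (Set.mem_insert _ _) (by rwa [e₁]) (by rwa [e₂])
  have key : ∀ s, Maximal (G.IndepIn (insert y A)) s →
      y ∈ s ∧ Maximal (G.IndepIn A) (s \ {y}) := by
    intro s hs
    rw [maximal_indepIn_iff] at hs
    obtain ⟨hs, hm⟩ := hs
    have hys : ∀ u ∈ insert y A, ¬ G.Adj y u := by
      rintro u (rfl | hu)
      · exact G.loopless.irrefl _
      · exact hy u hu
    refine ⟨?_, maximal_indepIn_iff.2 ⟨⟨?_, hs.2.mono Set.sdiff_subset⟩, ?_⟩⟩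
    · by_contra hc
      obtain ⟨t, ht, hty⟩ := hm y (Set.mem_insert _ _) hc
      exact hys t (hs.1 ht) hty.symm
    · exact fun u hu => (hs.1 hu.1).resolve_left hu.2
    · intro u hu hus
      have huy : u ≠ y := fun e => hyA (e ▸ hu)
      obtain ⟨t, ht, htu⟩ := hm u (.inr hu) (fun hc => hus ⟨hc, huy⟩)
      exact ⟨t, ⟨ht, fun e => hy u hu (by rwa [← show t = y from e])⟩, htu⟩
  intro s t hs ht
  rw [← Set.ncard_sdiff_singleton_add_one (key s hs).1,
    ← Set.ncard_sdiff_singleton_add_one (key t ht).1,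
    h.wellCoveredOn _ _ (key s hs).2 (key t ht).2]

/-! ### Leaves and basic five-cycles -/

/-- `G` has no cycle of length three or four. -/
structure NoShortCycle (G : SimpleGraph V) : Prop where
  triangle : ∀ {a b c : V}, G.Adj a b → G.Adj b c → ¬ G.Adj a c
  square : ∀ {a b c d : V}, a ≠ c → G.Adj a b → G.Adj b c → G.Adj a d → G.Adj d c → b = d

/-- `p` is a leaf of the subgraph induced on `A`, and `q` is its only neighbour. -/
structure IsLeafIn (G : SimpleGraph V) (A : Set V) (p q : V) : Prop where
  left_mem : p ∈ A
  right_mem : q ∈ A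
  adj : G.Adj p q
  eq_of_adj : ∀ u ∈ A, G.Adj p u → u = q

/-- In the subgraph induced on `A`, the vertex `a` has no neighbours besides `b` and `c`. -/
def NbrsIn (G : SimpleGraph V) (A : Set V) (a b c : V) : Prop :=
  ∀ u ∈ A, G.Adj a u → u = b ∨ u = c

theorem NbrsIn.symm {a b c : V} (h : G.NbrsIn A a b c) : G.NbrsIn A a c b :=
  fun u hu hau => (h u hu hau).symm

/-- `a b c d e` is a closed walk of length five in `A`. Without triangles, its vertices are
automatically distinct. -/
structure FiveCycleIn (G : SimpleGraph V) (A : Set V) (a b c d e : V) : Prop where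
  mem_a : a ∈ A
  mem_b : b ∈ A
  mem_c : c ∈ A
  mem_d : d ∈ A
  mem_e : e ∈ A
  ab : G.Adj a b
  bc : G.Adj b c
  cd : G.Adj c d
  de : G.Adj d e
  ea : G.Adj e a

/-- `a b c d e` is a basic five-cycle of the subgraph induced on `A`: of any two consecutive
vertices at least one has no neighbours off the cycle. -/
structure BasicFiveCycleIn (G : SimpleGraph V) (A : Set V) (a b c d e : V) : Prop
    extends FiveCycleIn G A a b c d e where
  nbrs_ab : G.NbrsIn A a e b ∨ G.NbrsIn A b a c
  nbrs_bc : G.NbrsIn A b a c ∨ G.NbrsIn A c b d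
  nbrs_cd : G.NbrsIn A c b d ∨ G.NbrsIn A d c e
  nbrs_de : G.NbrsIn A d c e ∨ G.NbrsIn A e d a
  nbrs_ea : G.NbrsIn A e d a ∨ G.NbrsIn A a e b

section FiveCycle

variable {a b c d e x r : V}

theorem FiveCycleIn.rotate (h : G.FiveCycleIn A a b c d e) : G.FiveCycleIn A b c d e a :=
  ⟨h.mem_b, h.mem_c, h.mem_d, h.mem_e, h.mem_a, h.bc, h.cd, h.de, h.ea, h.ab⟩

theorem FiveCycleIn.reflect (h : G.FiveCycleIn A a b c d e) : G.FiveCycleIn A a e d c b :=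
  ⟨h.mem_a, h.mem_e, h.mem_d, h.mem_c, h.mem_b, h.ea.symm, h.de.symm, h.cd.symm, h.bc.symm,
    h.ab.symm⟩

theorem FiveCycleIn.mono (h : G.FiveCycleIn A a b c d e) (hAB : A ⊆ B) :
    G.FiveCycleIn B a b c d e :=
  ⟨hAB h.mem_a, hAB h.mem_b, hAB h.mem_c, hAB h.mem_d, hAB h.mem_e, h.ab, h.bc, h.cd, h.de, h.ea⟩

theorem BasicFiveCycleIn.rotate (h : G.BasicFiveCycleIn A a b c d e) :
    G.BasicFiveCycleIn A b c d e a :=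
  ⟨h.toFiveCycleIn.rotate, h.nbrs_bc, h.nbrs_cd, h.nbrs_de, h.nbrs_ea, h.nbrs_ab⟩

theorem BasicFiveCycleIn.reflect (h : G.BasicFiveCycleIn A a b c d e) :
    G.BasicFiveCycleIn A a e d c b :=
  ⟨h.toFiveCycleIn.reflect, h.nbrs_ea.symm.imp .symm .symm, h.nbrs_de.symm.imp .symm .symm,
    h.nbrs_cd.symm.imp .symm .symm, h.nbrs_bc.symm.imp .symm .symm,
    h.nbrs_ab.symm.imp .symm .symm⟩

/-- On a five-cycle of a well-covered graph, if `a` and `d` have degree two, then `b` and `c`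
cannot both have neighbours `x`, `r` off the cycle: removing the closed neighbourhood of `{x, r}`
would make `a` and `d` two leaves at `e`. -/
theorem FiveCycleIn.false_of_outer_nbrs [Finite V] (hG : G.NoShortCycle) (h : G.WellCoveredOn A)
    (hc : G.FiveCycleIn A a b c d e) (ha : G.NbrsIn A a e b) (hd : G.NbrsIn A d c e)
    (hx : x ∈ A) (hr : r ∈ A) (hbx : G.Adj b x) (hcr : G.Adj c r) (hxa : x ≠ a) (hxc : x ≠ c)
    (hrb : r ≠ b) (hrd : r ≠ d) : False := by
  obtain ⟨hT, hQ⟩ := hG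
  obtain ⟨ma, mb, mc, md, me, ab, bc, cd, de, ea⟩ := hc
  have sym : ∀ p q, G.Adj p q → G.Adj q p := fun _ _ h => h.symm
  unfold NbrsIn at *
  have hxr : ¬ G.Adj x r := by grind
  have hxe : ¬ G.Adj x e := by grind
  have hre : ¬ G.Adj r e := by grind
  have hxa' : ¬ G.Adj x a := by grind
  have hra' : ¬ G.Adj r a := by grind
  have hxd' : ¬ G.Adj x d := by grind
  have hrd' : ¬ G.Adj r d := by grind
  refine h.not_two_leaves (indepIn_pair hx hr hxr) me ma md ?_ ea.symm de ?_ ?_ ?_ ?_ ?_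
  all_goals try simp only [Set.mem_insert_iff, Set.mem_singleton_iff, exists_eq_or_imp,
    exists_eq_left, forall_eq_or_imp, forall_eq]
  all_goals grind

/-- Two five-cycles sharing the edges `d c`, `c b` coincide if `d` has degree two in the second. -/
theorem FiveCycleIn.eq_of_shared_path (hG : G.NoShortCycle) (hc : G.FiveCycleIn A a b c d e)
    {u v : V} (hc' : G.FiveCycleIn B c b u v d) (hd : G.NbrsIn B d c e) : u = a := by
  have hv : v = e := (hd v hc'.mem_d hc'.de.symm).resolve_left fun e' =>
    hG.triangle hc'.bc hc'.cd (e' ▸ hc.bc)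
  subst hv
  have hbe : b ≠ v := fun e' => hG.triangle hc.bc hc.cd (e' ▸ hc.de.symm)
  exact hG.square hbe hc'.bc hc'.cd hc.ab.symm hc.ea.symm

end FiveCycle

/-! ### The local structure of vertex decomposable graphs without short cycles -/

/-- In the subgraph induced on `A`, the vertex `v` is isolated, a leaf, a neighbour of a leaf, or on
a basic five-cycle. -/
def StandardVertex (G : SimpleGraph V) (A : Set V) (v : V) : Prop :=
  (∀ u ∈ A, ¬ G.Adj v u) ∨ (∃ q, G.IsLeafIn A v q) ∨ (∃ p, G.IsLeafIn A p v) ∨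
    ∃ b c d e, G.BasicFiveCycleIn A v b c d e

section Deletion

variable {x : V}

/-- A cycle which is basic in `A \ {x}`, with `x` attached to its vertex `a`, has no
neighbour off the cycle at `b`. Otherwise `c` has degree two; if `e` has degree two as well, then
`false_of_outer_nbrs` applies, and if not, then `d` has degree two and `c` is not standard in
`A \ N[x]`. -/
theorem BasicFiveCycleIn.nbrs_of_adj_deleted [Finite V] (hG : G.NoShortCycle)
    (h : G.WellCoveredOn A) (hx : x ∈ A)
    (hK : ∀ v ∈ A \ G.closedNeighborSet x, G.StandardVertex (A \ G.closedNeighborSet x) v)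
    {a b c d e : V} (hc : G.BasicFiveCycleIn (A \ {x}) a b c d e) (hxa : G.Adj x a) :
    G.NbrsIn A b a c := by
  obtain ⟨hT, hQ⟩ := hG
  have sym : ∀ p q, G.Adj p q → G.Adj q p := fun _ _ h => h.symm
  have hC := hc.toFiveCycleIn.mono Set.sdiff_subset
  obtain ⟨⟨⟨ma, xa⟩, ⟨mb, xb⟩, ⟨mc, xc⟩, ⟨md, xd⟩, ⟨me, xe⟩, ab, bc, cd, de, ea⟩,
    n1, n2, n3, n4, n5⟩ := hc
  simp only [Set.mem_singleton_iff] at xa xb xc xd xe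
  have hxb : ¬ G.Adj x b := by grind
  have hxc : ¬ G.Adj x c := by grind
  have hxd : ¬ G.Adj x d := by grind
  have hxe : ¬ G.Adj x e := by grind
  have up : ∀ p q r, ¬ G.Adj x p → G.NbrsIn (A \ {x}) p q r → G.NbrsIn A p q r :=
    fun p q r hp hn u hu hpu => hn u ⟨hu, fun e => hp (by
      rw [Set.mem_singleton_iff] at e; subst e; exact hpu.symm)⟩ hpu
  by_contra hb
  have nc : G.NbrsIn A c b d := up _ _ _ hxc (n2.resolve_left fun hn => hb (up _ _ _ hxb hn))
  obtain ⟨w, mw, bw, hw⟩ : ∃ w ∈ A, G.Adj b w ∧ ¬ (w = a ∨ w = c) := by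
    simpa [NbrsIn] using hb
  by_cases he : G.NbrsIn (A \ {x}) e d a
  · refine hC.reflect.rotate.rotate.rotate.false_of_outer_nbrs ⟨hT, hQ⟩ h nc.symm
      (up _ _ _ hxe he).symm mw hx bw hxa.symm ?_ ?_ (Ne.symm xb) (Ne.symm xe)
    all_goals grind
  · have nd : G.NbrsIn A d c e := up _ _ _ hxd (n4.resolve_right he)
    obtain ⟨z, ⟨mz, hzx⟩, ez, hz⟩ : ∃ z ∈ A \ {x}, G.Adj e z ∧ ¬ (z = d ∨ z = a) := by
      simpa [NbrsIn, and_assoc] using he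
    have hxw : ¬ G.Adj x w := by grind
    have hxz : ¬ G.Adj x z := by grind
    have hwx : w ≠ x := by grind
    have mem : ∀ u ∈ A, u ≠ x → ¬ G.Adj x u → u ∈ A \ G.closedNeighborSet x :=
      fun u hu h1 h2 => ⟨hu, by simp [mem_closedNeighborSet, h1, h2]⟩
    have kb := mem b mb xb hxb
    have kc := mem c mc xc hxc
    have kd := mem d md xd hxd
    have ke := mem e me xe hxe
    have kw := mem w mw hwx hxw
    have sub : ∀ u ∈ A \ G.closedNeighborSet x, u ∈ A ∧ ¬ G.Adj x u :=
      fun u hu => ⟨hu.1, fun h => hu.2 (mem_closedNeighborSet.2 (.inl h))⟩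
    unfold NbrsIn at nc nd
    rcases hK c kc with hi | ⟨q, hl⟩ | ⟨p, hl⟩ | ⟨c₁, c₂, c₃, c₄, hl⟩
    · exact hi d kd cd
    · have := hl.eq_of_adj b kb bc.symm
      have := hl.eq_of_adj d kd cd
      grind
    · have h1 := hl.adj
      have := hl.eq_of_adj
      have := sub p hl.left_mem
      grind
    · have hl := hl.toFiveCycleIn
      have nd' : G.NbrsIn (A \ G.closedNeighborSet x) d c e := fun u hu => nd u hu.1
      have h14 : c₁ ≠ c₄ := fun e => hT hl.cd hl.de (e ▸ hl.bc.symm)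
      -- The second cycle runs through `b c d e`, and it avoids `a`: this creates a four-cycle.
      rcases nc c₁ hl.mem_b.1 hl.ab with rfl | rfl <;>
        rcases nc c₄ hl.mem_e.1 hl.ea.symm with rfl | rfl
      · exact h14 rfl
      · exact (sub _ hl.mem_c).2 (hC.eq_of_shared_path ⟨hT, hQ⟩ hl nd' ▸ hxa)
      · exact (sub _ hl.mem_d).2 (hC.eq_of_shared_path ⟨hT, hQ⟩ hl.reflect nd' ▸ hxa)
      · exact h14 rfl

/-- Basic five-cycles of `A \ {x}` stay basic in `A`. -/
theorem BasicFiveCycleIn.of_deleted [Finite V] (hG : G.NoShortCycle)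
    (h : G.WellCoveredOn A) (hx : x ∈ A)
    (hK : ∀ v ∈ A \ G.closedNeighborSet x, G.StandardVertex (A \ G.closedNeighborSet x) v)
    {a b c d e : V} (hc : G.BasicFiveCycleIn (A \ {x}) a b c d e) :
    G.BasicFiveCycleIn A a b c d e := by
  have up : ∀ p q r, ¬ G.Adj x p → G.NbrsIn (A \ {x}) p q r → G.NbrsIn A p q r :=
    fun p q r hp hn u hu hpu => hn u ⟨hu, fun e => hp (by
      rw [Set.mem_singleton_iff] at e; subst e; exact hpu.symm)⟩ hpu
  have key : ∀ {a b c d e : V}, G.BasicFiveCycleIn (A \ {x}) a b c d e →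
      G.NbrsIn A a e b ∨ G.NbrsIn A b a c := by
    intro a b c d e hc
    by_cases hxa : G.Adj x a
    · exact .inr (hc.nbrs_of_adj_deleted hG h hx hK hxa)
    by_cases hxb : G.Adj x b
    · exact .inl (hc.rotate.reflect.nbrs_of_adj_deleted hG h hx hK hxb).symm
    · exact hc.nbrs_ab.imp (up _ _ _ hxa) (up _ _ _ hxb)
  exact ⟨hc.toFiveCycleIn.mono Set.sdiff_subset, key hc, key hc.rotate, key hc.rotate.rotate,
    key hc.rotate.rotate.rotate, key hc.rotate.rotate.rotate.rotate⟩

theorem IsLeafIn.of_deleted {p q : V} (h : G.IsLeafIn (A \ {x}) p q) (hp : ¬ G.Adj x p) :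
    G.IsLeafIn A p q :=
  ⟨h.left_mem.1, h.right_mem.1, h.adj, fun u hu hpu => h.eq_of_adj u
    ⟨hu, fun e => hp (by rw [Set.mem_singleton_iff] at e; subst e; exact hpu.symm)⟩ hpu⟩

theorem IsLeafIn.eq_or_eq {p q : V} (h : G.IsLeafIn (A \ {x}) p q) {u : V} (hu : u ∈ A)
    (hpu : G.Adj p u) : u = x ∨ u = q :=
  or_iff_not_imp_left.2 fun hux => h.eq_of_adj u ⟨hu, hux⟩ hpu

/-- `w` is a vertex used to dominate the neighbour `y` of `x`, chosen so that `w` has as few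
neighbours as possible: the only neighbour of the leaf `y` of `A \ {x}`, or a leaf of `A \ {x}`
attached to `y`, or a neighbour of `y` of degree two on a basic five-cycle through `y`. -/
def Dominator (G : SimpleGraph V) (A : Set V) (x y w : V) : Prop :=
  G.IsLeafIn (A \ {x}) y w ∨ G.IsLeafIn (A \ {x}) w y ∨
    ∃ c d e, G.BasicFiveCycleIn (A \ {x}) y w e d c ∧ G.NbrsIn A w y e

theorem Dominator.adj {y w : V} (h : G.Dominator A x y w) : G.Adj y w := by
  rcases h with h | h | ⟨c, d, e, h, -⟩
  exacts [h.adj, h.adj.symm, h.ab]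

theorem Dominator.mem {y w : V} (h : G.Dominator A x y w) : w ∈ A \ {x} := by
  rcases h with h | h | ⟨c, d, e, h, -⟩
  exacts [h.right_mem, h.left_mem, h.mem_b]

/-- In a well-covered graph, a neighbour `b` of a degree-two vertex `a` of a five-cycle, itself on
the cycle, carries no leaf `p`: removing the closed neighbourhood of `c`, the vertex opposite to the
edge `a b`, would make `p` and `a` two leaves at `b`. -/
theorem FiveCycleIn.false_of_leaf [Finite V] (hG : G.NoShortCycle) (h : G.WellCoveredOn A)
    {a b c d e p : V} (hc : G.FiveCycleIn A e a b d c) (ha : G.NbrsIn A a e b)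
    (hp : G.IsLeafIn A p b) : False := by
  obtain ⟨hT, hQ⟩ := hG
  obtain ⟨me, ma, mb, md, mc, ea, ab, bd, dc, ce⟩ := hc
  obtain ⟨mp, -, pb, hp⟩ := hp
  have sym : ∀ p q, G.Adj p q → G.Adj q p := fun _ _ h => h.symm
  unfold NbrsIn at *
  refine h.not_two_leaves (indepIn_singleton mc) mb mp ma ?_ pb ab ?_ ?_ ?_ ?_ ?_
  all_goals try simp only [Set.mem_singleton_iff, exists_eq_left, forall_eq]
  all_goals grind

/-- Dominators of distinct neighbours of `x` are not adjacent, unless `x` is on a five-cycle with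
two leaves of `A \ {x}`. -/
theorem Dominator.not_adj [Finite V] (hG : G.NoShortCycle) (h : G.WellCoveredOn (A \ {x}))
    (hno : ∀ p q p' q', G.IsLeafIn (A \ {x}) p q → G.IsLeafIn (A \ {x}) p' q' → G.Adj x p →
      G.Adj x p' → ¬ G.Adj q q')
    {y w y' w' : V} (hxy : G.Adj x y) (hxy' : G.Adj x y')
    (hw : G.Dominator A x y w) (hw' : G.Dominator A x y' w') : ¬ G.Adj w w' := by
  have leaf : ∀ {y w y' w' : V}, G.IsLeafIn (A \ {x}) w y → G.Dominator A x y' w' → G.Adj x y →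
      G.Adj x y' → ¬ G.Adj w w' := by
    intro y w y' w' hl hw' hxy hxy' hww
    have := hl.eq_of_adj w' hw'.mem hww
    subst this
    exact hG.triangle hxy' hw'.adj hxy
  have cyc : ∀ {y w y' w' c d e : V}, G.IsLeafIn (A \ {x}) y w →
      G.BasicFiveCycleIn (A \ {x}) y' w' e d c → G.NbrsIn A w' y' e → G.Adj x y →
      G.Adj x y' → ¬ G.Adj w w' := by
    intro y w y' w' c d e hl hc hn hxy hxy' hww
    rcases hn w hl.right_mem.1 hww.symm with rfl | rfl
    · exact hG.triangle hxy hl.adj hxy'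
    · exact hc.toFiveCycleIn.false_of_leaf hG h (fun u hu => hn u hu.1) hl
  intro hww
  by_cases hyy : y = y'
  · subst hyy
    exact hG.triangle hw.adj hww hw'.adj
  have hw0 := hw
  have hw0' := hw'
  rcases hw with hw | hw | ⟨c, d, e, hw, hn⟩
  · rcases hw' with hw' | hw' | ⟨c', d', e', hw', hn'⟩
    · exact hno _ _ _ _ hw hw' hxy hxy' hww
    · exact leaf hw' hw0 hxy' hxy hww.symm
    · exact cyc hw hw' hn' hxy hxy' hww
  · exact leaf hw hw0' hxy hxy' hww
  · rcases hw' with hw' | hw' | ⟨c', d', e', hw', hn'⟩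
    · exact cyc hw' hw hn hxy' hxy hww.symm
    · exact leaf hw' hw0 hxy' hxy hww.symm
    · -- Each of `w`, `w'` is the third vertex of the cycle of the other one, so that the fourth
      -- vertex `d'` of the second cycle, being adjacent to `w`, is `y` or `w'`.
      obtain ⟨hT, hQ⟩ := hG
      have sym : ∀ p q, G.Adj p q → G.Adj q p := fun _ _ h => h.symm
      have h1 := hn w' hw'.mem_b.1 hww
      have h2 := hn' w hw.mem_b.1 hww.symm
      have h3 := hn d' hw'.mem_d.1
      obtain ⟨⟨m1, m2, m3, m4, m5, a1, a2, a3, a4, a5⟩, -⟩ := hw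
      obtain ⟨⟨k1, k2, k3, k4, k5, b1, b2, b3, b4, b5⟩, -⟩ := hw'
      have := m5.2
      have := k5.2
      simp only [Set.mem_singleton_iff] at *
      grind

/-- If `x` carries a leaf `y`, and `p` is a leaf of `A \ {x}` adjacent to `x`, then the neighbour
`q` of `p` is itself a leaf: removing the closed neighbourhood of a further neighbour of `q` would
make `y` and `p` two leaves at `x`. -/
theorem IsLeafIn.swap_of_leaf [Finite V] (hG : G.NoShortCycle) (h : G.WellCoveredOn A)
    {y p q : V} (hy : G.IsLeafIn A y x) (hp : G.IsLeafIn (A \ {x}) p q) (hxp : G.Adj x p) :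
    G.IsLeafIn A q p := by
  refine ⟨hp.right_mem.1, hp.left_mem.1, hp.adj.symm, fun s hs hqs => ?_⟩
  by_contra hsp
  have hp' := @hp.eq_or_eq
  obtain ⟨my, mx, yx, hy⟩ := hy
  obtain ⟨mp, mq, pq, hp⟩ := hp
  obtain ⟨hT, hQ⟩ := hG
  have sym : ∀ p q, G.Adj p q → G.Adj q p := fun _ _ h => h.symm
  refine h.not_two_leaves (indepIn_singleton hs) mx my mp.1 ?_ yx hxp.symm ?_ ?_ ?_ ?_ ?_
  all_goals try simp only [Set.mem_singleton_iff, exists_eq_left, forall_eq]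
  all_goals grind

/-- If `x` is on a five-cycle `x p q q' p'` with leaves `p`, `p'` of `A \ {x}`, then every further
leaf `p₀` of `A \ {x}` at `x` has a leaf for its neighbour: a further neighbour `s` of `q₀`,
together with `q`, would isolate `p₀` and `p'` as two leaves at `x`. -/
theorem IsLeafIn.false_of_fiveCycle [Finite V] (hG : G.NoShortCycle) (h : G.WellCoveredOn A)
    (hx : x ∈ A) {p q p' q' p₀ q₀ s : V} (hp : G.IsLeafIn (A \ {x}) p q)
    (hp' : G.IsLeafIn (A \ {x}) p' q') (hp₀ : G.IsLeafIn (A \ {x}) p₀ q₀) (hxp : G.Adj x p)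
    (hxp' : G.Adj x p') (hxp₀ : G.Adj x p₀) (hqq : G.Adj q q') (h1 : p₀ ≠ p) (h2 : p₀ ≠ p')
    (hs : s ∈ A) (hqs : G.Adj q₀ s) (hsp : s ≠ p₀) (hsq' : s ≠ q') (hsq : ¬ G.Adj s q) :
    False := by
  have e := @hp.eq_or_eq
  have e' := @hp'.eq_or_eq
  have e₀ := @hp₀.eq_or_eq
  obtain ⟨⟨mp, -⟩, ⟨mq, xq⟩, pq, -⟩ := hp
  obtain ⟨⟨mp', -⟩, ⟨mq', xq'⟩, pq', -⟩ := hp'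
  obtain ⟨⟨mp₀, -⟩, ⟨mq₀, xq₀⟩, pq₀, -⟩ := hp₀
  obtain ⟨hT, hQ⟩ := hG
  have sym : ∀ p q, G.Adj p q → G.Adj q p := fun _ _ h => h.symm
  simp only [Set.mem_singleton_iff] at xq xq' xq₀
  have hsx : s ≠ x := by grind
  have hnsx : ¬ G.Adj s x := by grind
  refine h.not_two_leaves (indepIn_pair hs mq hsq) hx mp' mp₀ h2.symm hxp'.symm hxp₀.symm
    ?_ ?_ ?_ ?_ ?_
  all_goals try simp only [Set.mem_insert_iff, Set.mem_singleton_iff, exists_eq_or_imp,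
    exists_eq_left, forall_eq_or_imp, forall_eq]
  all_goals grind

theorem StandardVertex.of_isLeafIn_left {p q : V} (h : G.IsLeafIn A p q) :
    G.StandardVertex A p := .inr (.inl ⟨q, h⟩)

theorem StandardVertex.of_isLeafIn_right {p q : V} (h : G.IsLeafIn A p q) :
    G.StandardVertex A q := .inr (.inr (.inl ⟨p, h⟩))

theorem BasicFiveCycleIn.standardVertex {a b c d e : V} (h : G.BasicFiveCycleIn A a b c d e) :
    G.StandardVertex A a := .inr (.inr (.inr ⟨b, c, d, e, h⟩))

/-- The five-cycle through `x` and two leaves of `A \ {x}` with adjacent neighbours is basic. -/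
theorem IsLeafIn.basicFiveCycleIn [Finite V] (hG : G.NoShortCycle) (h : G.WellCoveredOn A)
    (hx : x ∈ A) {p q p' q' : V} (hp : G.IsLeafIn (A \ {x}) p q)
    (hp' : G.IsLeafIn (A \ {x}) p' q') (hxp : G.Adj x p) (hxp' : G.Adj x p')
    (hqq : G.Adj q q') : G.BasicFiveCycleIn A x p q q' p' := by
  have np : G.NbrsIn A p x q := fun u => hp.eq_or_eq
  have np' : G.NbrsIn A p' x q' := fun u => hp'.eq_or_eq
  have hc : G.FiveCycleIn A x p q q' p' := ⟨hx, hp.left_mem.1, hp.right_mem.1, hp'.right_mem.1,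
    hp'.left_mem.1, hxp, hp.adj, hqq, hp'.adj.symm, hxp'.symm⟩
  refine ⟨hc, .inr np, .inl np, ?_, .inr np'.symm, .inl np'.symm⟩
  by_contra! hn
  obtain ⟨hn, hn'⟩ := hn
  obtain ⟨r, mr, hqr, hr⟩ : ∃ r ∈ A, G.Adj q r ∧ ¬ (r = p ∨ r = q') := by
    simpa [NbrsIn] using hn
  obtain ⟨s, ms, hqs, hs⟩ : ∃ s ∈ A, G.Adj q' s ∧ ¬ (s = q ∨ s = p') := by
    simpa [NbrsIn] using hn'
  rw [not_or] at hr hs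
  exact hc.rotate.false_of_outer_nbrs hG h np np'.symm mr ms hqr hqs hr.1 hr.2 hs.1 hs.2

/-- All leaves of `A \ {x}` adjacent to `x`, and their neighbours, are standard in `A`; and so is
`x`. -/
theorem standardVertex_near_deleted [Finite V] (hG : G.NoShortCycle) (h : G.WellCoveredOn A)
    (h' : G.WellCoveredOn (A \ {x})) (hx : x ∈ A)
    (hH : ∀ v ∈ A \ {x}, G.StandardVertex (A \ {x}) v)
    (hK : ∀ v ∈ A \ G.closedNeighborSet x, G.StandardVertex (A \ G.closedNeighborSet x) v) :
    G.StandardVertex A x ∧ ∀ p q, G.IsLeafIn (A \ {x}) p q → G.Adj x p →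
      G.StandardVertex A p ∧ G.StandardVertex A q := by
  by_cases hiso : ∀ u ∈ A, ¬ G.Adj x u
  · exact ⟨.inl hiso, fun p q hp hxp => absurd hxp (hiso p hp.left_mem.1)⟩
  by_cases hleaf : ∃ y, G.IsLeafIn A y x
  · obtain ⟨y, hy⟩ := hleaf
    refine ⟨.of_isLeafIn_right hy, fun p q hp hxp => ?_⟩
    have := hy.swap_of_leaf hG h hp hxp
    exact ⟨.of_isLeafIn_right this, .of_isLeafIn_left this⟩
  by_cases hno : ∀ p q p' q', G.IsLeafIn (A \ {x}) p q → G.IsLeafIn (A \ {x}) p' q' →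
      G.Adj x p → G.Adj x p' → ¬ G.Adj q q'
  · -- Choosing all dominators of neighbours of `x` gives an independent set that must not exist.
    exfalso
    push Not at hiso
    obtain ⟨y₀, my₀, hxy₀⟩ := hiso
    refine h.not_dominates_neighbors (S := {w | ∃ y, G.Adj x y ∧ G.Dominator A x y w}) h' hx my₀
      hxy₀ ⟨fun w ⟨y, _, hw⟩ => hw.mem.1, ?_⟩ ?_ ?_
    · rintro w ⟨y, hxy, hw⟩ w' ⟨y', hxy', hw'⟩ -
      exact hw.not_adj hG h' hno hxy hxy' hw'
    · exact fun ⟨y, _, hw⟩ => hw.mem.2 rfl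
    · intro y hy hxy
      suffices ∃ w, G.Dominator A x y w from
        this.imp fun w hw => ⟨⟨y, hxy, hw⟩, hw.adj.symm⟩
      rcases hH y ⟨hy, fun e => hxy.ne e.symm⟩ with hi | ⟨q, hl⟩ | ⟨p, hl⟩ | ⟨b, c, d, e, hc⟩
      · refine absurd ⟨y, hy, hx, hxy.symm, fun u hu hyu => ?_⟩ hleaf
        by_contra hux
        exact hi u ⟨hu, hux⟩ hyu
      · exact ⟨q, .inl hl⟩
      · exact ⟨p, .inr (.inl hl)⟩
      · -- Since `y` has the neighbour `x` off the cycle, its cycle neighbours have degree two.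
        refine ⟨b, .inr (.inr ⟨e, d, c, hc, ?_⟩)⟩
        refine (hc.of_deleted hG h hx hK).nbrs_ab.resolve_left fun hn => ?_
        rcases hn x hx hxy.symm with e' | e'
        · exact hc.mem_e.2 e'.symm
        · exact hc.mem_b.2 e'.symm
  · push Not at hno
    obtain ⟨p, q, p', q', hp, hp', hxp, hxp', hqq⟩ := hno
    have hc := hp.basicFiveCycleIn hG h hx hp' hxp hxp' hqq
    refine ⟨hc.standardVertex, fun p₀ q₀ hp₀ hxp₀ => ?_⟩
    by_cases h1 : p₀ = p
    · subst h1
      obtain rfl : q₀ = q := hp.eq_of_adj _ hp₀.right_mem hp₀.adj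
      exact ⟨hc.rotate.standardVertex, hc.rotate.rotate.standardVertex⟩
    by_cases h2 : p₀ = p'
    · subst h2
      obtain rfl : q₀ = q' := hp'.eq_of_adj _ hp₀.right_mem hp₀.adj
      exact ⟨hc.reflect.rotate.standardVertex, hc.reflect.rotate.rotate.standardVertex⟩
    have hl : G.IsLeafIn A q₀ p₀ := by
      refine ⟨hp₀.right_mem.1, hp₀.left_mem.1, hp₀.adj.symm, fun s hs hqs => ?_⟩
      by_contra hsp
      by_cases hs' : s ≠ q' ∧ ¬ G.Adj s q
      · exact hp.false_of_fiveCycle hG h hx hp' hp₀ hxp hxp' hxp₀ hqq h1 h2 hs hqs hsp hs'.1 hs'.2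
      · refine hp'.false_of_fiveCycle hG h hx hp hp₀ hxp' hxp hxp₀ hqq.symm h2 h1 hs hqs hsp ?_ ?_
        · rintro rfl
          exact hs' ⟨hqq.ne, G.loopless.irrefl _⟩
        · intro hsq'
          refine hs' ⟨hsq'.ne, fun hsq => hG.triangle hsq hqq hsq'⟩
    exact ⟨.of_isLeafIn_right hl, .of_isLeafIn_left hl⟩

end Deletion

/-- Every vertex of a vertex decomposable graph without cycles of length three or four is
standard. -/
theorem VertexDecomposableOn.standardVertex [Finite V] (hG : G.NoShortCycle)
    (h : G.VertexDecomposableOn A) : ∀ v ∈ A, G.StandardVertex A v := by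
  induction h with
  | isolated A hwc hA => exact fun v hv => .inl (hA v hv)
  | shedding A hwc x hx h₁ h₂ ih₁ ih₂ =>
    intro v hv
    obtain ⟨hsx, hs⟩ := standardVertex_near_deleted hG hwc h₁.wellCoveredOn hx ih₁ ih₂
    by_cases hvx : v = x
    · rwa [hvx]
    rcases ih₁ v ⟨hv, hvx⟩ with hi | ⟨q, hl⟩ | ⟨p, hl⟩ | ⟨b, c, d, e, hc⟩
    · have hi' : ∀ u ∈ A, G.Adj v u → u = x := fun u hu hvu =>
        by_contra fun hux => hi u ⟨hu, hux⟩ hvu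
      by_cases hxv : G.Adj v x
      · exact .of_isLeafIn_left ⟨hv, hx, hxv, hi'⟩
      · exact .inl fun u hu hvu => hxv (hi' u hu hvu ▸ hvu)
    · by_cases hxv : G.Adj x v
      · exact (hs v q hl hxv).1
      · exact .of_isLeafIn_left (hl.of_deleted hxv)
    · by_cases hxp : G.Adj x p
      · exact (hs p v hl hxp).2
      · exact .of_isLeafIn_right (hl.of_deleted hxp)
    · exact (hc.of_deleted hG hwc hx ih₂).standardVertex

/-! ### Shedding vertices -/

/-- The neighbour `q` of a leaf `p` can be deleted: `A \ {q}` is the link of `p` together with the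
isolated vertex `p`. -/
theorem VertexDecomposableOn.diff_singleton_of_isLeafIn [Finite V]
    (h : G.VertexDecomposableOn A) {p q : V} (hp : G.IsLeafIn A p q) :
    G.VertexDecomposableOn (A \ {q}) := by
  have hpq := hp.adj.ne
  have e : A \ {q} = insert p (A \ G.closedNeighborSet p) := by
    ext u
    have h1 := hp.eq_of_adj u
    have h2 := hp.left_mem
    have h3 := hp.adj
    simp only [Set.mem_sdiff, Set.mem_singleton_iff, Set.mem_insert_iff, mem_closedNeighborSet]
    grind
  rw [e]
  refine (h.diff_closedNeighborSet p hp.left_mem).insert_isolated ?_ ?_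
  · simp [mem_closedNeighborSet]
  · exact fun u hu hpu => hu.2 (mem_closedNeighborSet.2 (.inl hpu))

/-- A vertex `a` of a five-cycle can be deleted when `b`, `d`, `e` have degree two: in `A \ {a}` the
vertex `c` is a shedding vertex, since `b` is a leaf attached to it. -/
theorem VertexDecomposableOn.diff_singleton_of_fiveCycleIn [Finite V] (hG : G.NoShortCycle)
    (h : G.VertexDecomposableOn A) {a b c d e : V} (hc : G.FiveCycleIn A a b c d e)
    (hb : G.NbrsIn A b a c) (hd : G.NbrsIn A d c e) (he : G.NbrsIn A e d a) :
    G.VertexDecomposableOn (A \ {a}) := by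
  obtain ⟨hT, hQ⟩ := hG
  have sym : ∀ p q, G.Adj p q → G.Adj q p := fun _ _ h => h.symm
  obtain ⟨ma, mb, mc, md, me, ab, bc, cd, de, ea⟩ := hc
  have hac : a ≠ c := by grind
  have hbe : ¬ G.Adj c e := by grind
  have hca : ¬ G.Adj c a := by grind
  unfold NbrsIn at *
  refine .shedding _ ?_ c ⟨mc, hac.symm⟩ ?_ ?_
  · -- A maximal independent set of `A \ {a}` missing `N(a)` would contain both `c` and `d`.
    have key : ∀ s, Maximal (G.IndepIn (A \ {a})) s → Maximal (G.IndepIn A) s := by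
      intro s hs
      rw [maximal_indepIn_iff] at hs ⊢
      obtain ⟨hs, hm⟩ := hs
      refine ⟨⟨hs.1.trans Set.sdiff_subset, hs.2⟩, fun v hv hvs => ?_⟩
      by_cases hva : v = a
      · subst hva
        by_contra! hn
        have hbs : b ∉ s := fun hb => hn b hb ab.symm
        have hes : e ∉ s := fun he => hn e he ea
        obtain ⟨u, hu, hub⟩ := hm b ⟨mb, ab.ne'⟩ hbs
        obtain ⟨w, hw, hwe⟩ := hm e ⟨me, ea.ne⟩ hes
        have hu' := (hb u (hs.1 hu).1 hub.symm).resolve_left (hs.1 hu).2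
        have hw' := (he w (hs.1 hw).1 hwe.symm).resolve_right (hs.1 hw).2
        subst hu' hw'
        exact hs.not_adj hu hw cd
      · exact hm v ⟨hv, hva⟩ hvs
    exact fun s t hs ht => h.wellCoveredOn s t (key s hs) (key t ht)
  · have e₁ : (A \ {a}) \ {c} = insert b (A \ G.closedNeighborSet b) := by
      ext u
      have h1 := hb u
      simp only [Set.mem_sdiff, Set.mem_singleton_iff, Set.mem_insert_iff, mem_closedNeighborSet]
      grind
    rw [e₁]
    refine (h.diff_closedNeighborSet b mb).insert_isolated ?_ ?_
    · simp [mem_closedNeighborSet]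
    · exact fun u hu hpu => hu.2 (mem_closedNeighborSet.2 (.inl hpu))
  · rw [Set.sdiff_sdiff_comm]
    refine (h.diff_closedNeighborSet c mc).diff_singleton_of_isLeafIn (p := e) ⟨⟨me, ?_⟩,
      ⟨ma, ?_⟩, ea, ?_⟩
    · rw [mem_closedNeighborSet]; grind
    · rw [mem_closedNeighborSet]; grind
    · rintro u ⟨hu, hun⟩ heu
      rw [mem_closedNeighborSet] at hun
      grind

/-- Among a vertex `a` of a basic five-cycle and its two cycle neighbours there is one whose cycle
neighbours both have degree two, together with one of the two vertices opposite to it; this one can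
be deleted. -/
theorem VertexDecomposableOn.exists_diff_singleton_of_basicFiveCycleIn [Finite V]
    (hG : G.NoShortCycle) (h : G.VertexDecomposableOn A) {a b c d e : V}
    (hc : G.BasicFiveCycleIn A a b c d e) :
    ∃ y ∈ A, (y = a ∨ G.Adj a y) ∧ G.VertexDecomposableOn (A \ {y}) := by
  have key : ∀ {a b c d e : V}, G.BasicFiveCycleIn A a b c d e → G.NbrsIn A b a c →
      G.NbrsIn A d c e → G.NbrsIn A e d a → G.VertexDecomposableOn (A \ {a}) :=
    fun hc => h.diff_singleton_of_fiveCycleIn hG hc.toFiveCycleIn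
  have Ka := key hc
  have Kb := key hc.rotate
  have Kb' := key hc.rotate.reflect
  have Ke := key hc.rotate.rotate.rotate.rotate
  have Ke' := key hc.rotate.rotate.rotate.rotate.reflect
  have Ka' := key hc.reflect
  have sw : ∀ p q r, G.NbrsIn A p q r → G.NbrsIn A p r q := fun _ _ _ h => h.symm
  have : G.VertexDecomposableOn (A \ {a}) ∨ G.VertexDecomposableOn (A \ {b}) ∨
      G.VertexDecomposableOn (A \ {e}) := by
    obtain ⟨-, n1, n2, n3, n4, n5⟩ := hc
    grind
  rcases this with h' | h' | h'
  exacts [⟨a, hc.mem_a, .inl rfl, h'⟩, ⟨b, hc.mem_b, .inr hc.ab, h'⟩,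
    ⟨e, hc.mem_e, .inr hc.ea.symm, h'⟩]

/-- In a vertex decomposable graph without short cycles, each vertex equals or is adjacent to a
vertex that can be deleted. -/
theorem VertexDecomposableOn.exists_diff_singleton [Finite V] (hG : G.NoShortCycle)
    (h : G.VertexDecomposableOn A) {v : V} (hv : v ∈ A) :
    ∃ y ∈ A, (y = v ∨ G.Adj v y) ∧ G.VertexDecomposableOn (A \ {y}) := by
  rcases h.standardVertex hG v hv with hi | ⟨q, hl⟩ | ⟨p, hl⟩ | ⟨b, c, d, e, hc⟩
  · refine ⟨v, hv, .inl rfl, ?_⟩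
    have := h.diff_closedNeighborSet v hv
    rwa [show A \ G.closedNeighborSet v = A \ {v} from ?_] at this
    ext u
    simp only [Set.mem_sdiff, mem_closedNeighborSet, Set.mem_singleton_iff]
    grind
  · exact ⟨q, hl.right_mem, .inr hl.adj, h.diff_singleton_of_isLeafIn hl⟩
  · exact ⟨v, hv, .inl rfl, h.diff_singleton_of_isLeafIn hl⟩
  · exact h.exists_diff_singleton_of_basicFiveCycleIn hG hc

theorem noShortCycle_of_five_le_egirth (h : 5 ≤ G.egirth) : G.NoShortCycle := by
  rw [le_egirth] at h
  constructor
  · intro a b c hab hbc hac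
    have hw : (Walk.cons hab (.cons hbc (.cons hac.symm .nil))).IsCycle := by
      have := hab.ne; have := hbc.ne; have := hac.ne
      simp [Walk.isCycle_def, Walk.isTrail_def]
      grind
    have := h a _ hw
    simp only [Walk.length_cons, Walk.length_nil] at this
    exact absurd this (by decide)
  · intro a b c d hac hab hbc had hdc
    by_contra hbd
    have hw : (Walk.cons hab (.cons hbc (.cons hdc.symm (.cons had.symm .nil)))).IsCycle := by
      have := hab.ne; have := hbc.ne; have := had.ne; have := hdc.ne
      simp [Walk.isCycle_def, Walk.isTrail_def]
      grind
    have := h a _ hw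
    simp only [Walk.length_cons, Walk.length_nil] at this
    exact absurd this (by decide)

end SimpleGraph

theorem theorem5p3 {V : Type u} [Finite V] (G : SimpleGraph V) (hgirth : 5 ≤ G.egirth)
    (hvd : G.IsVertexDecomposable) : G.IsDominatingSet G.shed := by
  intro v hv
  have hG := SimpleGraph.noShortCycle_of_five_le_egirth hgirth
  have h := SimpleGraph.vertexDecomposableOn_univ hvd
  obtain ⟨y, hy, hvy, hdel⟩ := h.exists_diff_singleton hG (Set.mem_univ v)
  have hys : y ∈ G.shed :=
    SimpleGraph.mem_shed_of_vertexDecomposableOn hdel (h.diff_closedNeighborSet y hy)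
  rcases hvy with rfl | hvy
  · exact absurd hys hv
  · exact ⟨y, hys, hvy⟩
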